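/- Let $D$ be a diagram of a knot with crossing set $E$. A set $S\subseteq E$ is an unknotting set if switching (exchanging over- and under-strand at) all crossings in $S$ turns $D$ into a diagram of the unknot. A set $W\subseteq E$ is U-independent if $W\setminus S$ is not an unknotting set for every non-empty $S\subseteq W$. The U-independent sets form an independence system on $E$ (a non-empty family of subsets closed under taking subsets), the U-independence system of $D$. An independence system on $E$ is called a matroid if its members are the independent sets of a matroid on $E$; equivalently, if for any two maximal members $M_1,M_2$ and every $x\in M_1$ there is $y\in M_2$ such that $(M_1\setminus\{x\})\cup\{y\}$ is again a maximal member. For non-zero integers $c_1,\dots,c_j$ let $D(c_1,\dots,c_j)$ be the standard diagram with Conway notation $(c_1,\dots,c_j)$: the 4-plat diagram with consecutive rows of $|c_1|,\dots,|c_j|$ crossings, lying alternately between the two middle strands and between the two left strands, the sign of $c_i$ giving the handedness of the $i$-th row, with signs normalized so that the diagram is alternating if all $c_i$ are positive. **Proposition.** (a) For every $n\ge 2$, the U-independence system of the alternating diagram $D(2n+1,1,2n)$ is not a matroid, and neither is that of the non-alternating diagram $D(2n+1,2,-2,2,-2,\dots,2,-2)$, with $n$ pairs $2,-2$. (b) For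 every $n\ge 1$, the U-independence system of $D(2n+1)$ is a matroid. (c) For every $n\ge 2$, the U-independence system of $D(2n,2)$ is not a matroid. -/

import Mathlib

/-! Link diagrams in Morse position: a generic diagram in the plane is cut by horizontal lines into
layers, each of which contains one cup, one cap or one crossing next to vertical strands. -/

/-- The non-vertical part of a layer. `cross true` is the crossing in which the strand that runs
from bottom left to top right is the over-strand; in `cross false` it is the under-strand. -/
inductive Piece : Type
  | cup : Piece
  | cap : Piece
  | cross : Bool → Piece

namespace Piece

/-- The number of strands entering a piece from below. -/
def inputs : Piece → ℕ
  | cup => 0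
  | cap => 2
  | cross _ => 2

/-- The number of strands leaving a piece at the top. -/
def outputs : Piece → ℕ
  | cup => 2
  | cap => 0
  | cross _ => 2

/-- Whether the piece is a crossing. -/
def IsCrossing : Piece → Prop
  | cross _ => True
  | _ => False

/-- Switching a crossing exchanges its over- and under-strand. -/
def switch : Piece → Piece
  | cross b => cross (!b)
  | p => p

end Piece

/-- A layer: a piece with `pos` vertical strands to its left (strands are numbered from the left,
starting at `0`), and the remaining strands to its right. -/
structure Layer : Type where
  piece : Piece
  pos : ℕ

namespace Layer

/-- A cup (local minimum) creating the strands `i` and `i + 1`. -/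
def cup (i : ℕ) : Layer := ⟨Piece.cup, i⟩

/-- A cap (local maximum) joining the strands `i` and `i + 1`. -/
def cap (i : ℕ) : Layer := ⟨Piece.cap, i⟩

/-- A crossing of the strands `i` and `i + 1`. -/
def cross (i : ℕ) (b : Bool) : Layer := ⟨Piece.cross b, i⟩

/-- Switch the crossing of a layer, if it has one. -/
def switch (L : Layer) : Layer := ⟨L.piece.switch, L.pos⟩

end Layer

/-- The number of strands above a stack of layers (read from bottom to top) that has `m` strands
below it; `none` if some layer does not fit. -/
def widthAfter : ℕ → List Layer → Option ℕ
  | m, [] => some m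
  | m, L :: l =>
    if L.pos + L.piece.inputs ≤ m then
      widthAfter (m - L.piece.inputs + L.piece.outputs) l
    else none

/-- A link diagram in Morse position: a stack of layers with no free ends. -/
structure LinkDiagram : Type where
  layers : List Layer
  closed : widthAfter 0 layers = some 0

/-- The local moves between stacks of layers: exchange of the heights of two distant layers,
straightening of a zigzag, sliding a strand over or under a local extremum, and the three
Reidemeister moves. -/
inductive LocalMove : List Layer → List Layer → Prop
  /-- Two pieces side by side, with `k` vertical strands between them, exchange heights. -/
  | exchange (p q : Piece) (i k : ℕ) :
      LocalMove [⟨p, i⟩, ⟨q, i + p.outputs + k⟩] [⟨q, i + p.inputs + k⟩, ⟨p, i⟩]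
  | zigzag_left (i : ℕ) : LocalMove [Layer.cup i, Layer.cap (i + 1)] []
  | zigzag_right (i : ℕ) : LocalMove [Layer.cup (i + 1), Layer.cap i] []
  | slide_cap (i : ℕ) (b : Bool) :
      LocalMove [Layer.cross i b, Layer.cap (i + 1)] [Layer.cross (i + 1) (!b), Layer.cap i]
  | slide_cup (i : ℕ) (b : Bool) :
      LocalMove [Layer.cup i, Layer.cross (i + 1) b] [Layer.cup (i + 1), Layer.cross i (!b)]
  | reidemeister_one_cap (i : ℕ) (b : Bool) :
      LocalMove [Layer.cross i b, Layer.cap i] [Layer.cap i]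
  | reidemeister_one_cup (i : ℕ) (b : Bool) :
      LocalMove [Layer.cup i, Layer.cross i b] [Layer.cup i]
  | reidemeister_two (i : ℕ) (b : Bool) :
      LocalMove [Layer.cross i b, Layer.cross i (!b)] []
  /-- The condition says that the three strands lie at three different heights (it excludes
  exactly the two cyclic over/under patterns). -/
  | reidemeister_three (i : ℕ) (a b c : Bool) (h : a = b ∨ b = c) :
      LocalMove [Layer.cross i a, Layer.cross (i + 1) b, Layer.cross i c]
        [Layer.cross (i + 1) c, Layer.cross i b, Layer.cross (i + 1) a]

namespace LinkDiagram

/-- One local move applied somewhere inside a link diagram. -/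
def Step (D D' : LinkDiagram) : Prop :=
  ∃ below above x y : List Layer, LocalMove x y ∧
    D.layers = below ++ x ++ above ∧ D'.layers = below ++ y ++ above

/-- Isotopy of the links represented by two diagrams: the diagrams are connected by a finite
sequence of local moves and inverses of local moves. -/
def Isotopic : LinkDiagram → LinkDiagram → Prop := Relation.EqvGen Step

/-- The diagram of the unknot without crossings. -/
def circle : LinkDiagram := ⟨[Layer.cup 0, Layer.cap 0], rfl⟩

/-- The diagram represents the unknot. -/
def IsUnknot (D : LinkDiagram) : Prop := D.Isotopic circle

/-- The set of crossings of a diagram. -/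
def Crossing (D : LinkDiagram) : Type :=
  {k : Fin D.layers.length // (D.layers.get k).piece.IsCrossing}

end LinkDiagram

theorem widthAfter_congr {l l' : List Layer}
    (h : List.Forall₂ (fun L L' : Layer => L.pos = L'.pos ∧
      L.piece.inputs = L'.piece.inputs ∧ L.piece.outputs = L'.piece.outputs) l l') (m : ℕ) :
    widthAfter m l = widthAfter m l' := by
  induction h generalizing m with
  | nil => rfl
  | cons hd _ ih =>
    obtain ⟨h1, h2, h3⟩ := hd
    simp only [widthAfter, h1, h2, h3, ih]

open Classical in
/-- The layers of a diagram after switching the crossings in `S`. -/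
noncomputable def LinkDiagram.switchLayers (D : LinkDiagram) (S : Set D.Crossing) : List Layer :=
  List.ofFn fun k : Fin D.layers.length =>
    if ∃ c ∈ S, c.1 = k then (D.layers.get k).switch else D.layers.get k

theorem LinkDiagram.switchLayers_closed (D : LinkDiagram) (S : Set D.Crossing) :
    widthAfter 0 (D.switchLayers S) = some 0 := by
  rw [← D.closed]
  apply widthAfter_congr
  rw [List.forall₂_iff_get]
  refine ⟨by simp [LinkDiagram.switchLayers], fun i h1 h2 => ?_⟩
  simp only [LinkDiagram.switchLayers, List.get_eq_getElem, List.getElem_ofFn]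
  split_ifs
  · rcases D.layers[i] with ⟨_ | _ | _, _⟩ <;> exact ⟨rfl, rfl, rfl⟩
  · exact ⟨rfl, rfl, rfl⟩

/-- A family of subsets of a ground set that is non-empty and closed under taking subsets. -/
structure IndependenceSystem (E : Type*) where
  Indep : Set E → Prop
  nonempty : ∃ I, Indep I
  hereditary : ∀ I J, Indep J → I ⊆ J → Indep I

/-- The independent sets of the system are the independent sets of a matroid on its ground set. -/
def IndependenceSystem.IsMatroid {E : Type*} (A : IndependenceSystem E) : Prop :=
  ∃ M : Matroid E, M.E = Set.univ ∧ ∀ I : Set E, M.Indep I ↔ A.Indep I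

namespace LinkDiagram

/-- The diagram obtained by switching the crossings in `S`. -/
noncomputable def switch (D : LinkDiagram) (S : Set D.Crossing) : LinkDiagram :=
  ⟨D.switchLayers S, D.switchLayers_closed S⟩

/-- Switching the crossings in `S` turns the diagram into a diagram of the unknot. -/
def IsUnknottingSet (D : LinkDiagram) (S : Set D.Crossing) : Prop := (D.switch S).IsUnknot

/-- No set obtained from `W` by removing at least one crossing is an unknotting set. -/
def UIndependent (D : LinkDiagram) (W : Set D.Crossing) : Prop :=
  ∀ S ⊆ W, S.Nonempty → ¬ D.IsUnknottingSet (W \ S)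

/-- The independence system formed by the U-independent sets of crossings. -/
def uSystem (D : LinkDiagram) : IndependenceSystem D.Crossing where
  Indep := D.UIndependent
  nonempty := ⟨∅, fun _ hS hne => absurd (Set.subset_empty_iff.1 hS) hne.ne_empty⟩
  hereditary := by
    intro I J hJ hIJ S hS hne
    have h := hJ (S ∪ J \ I) (Set.union_subset (hS.trans hIJ) Set.sdiff_subset)
      (hne.mono Set.subset_union_left)
    have e : J \ (S ∪ J \ I) = I \ S := by
      ext x
      have := @hIJ x
      simp only [Set.mem_sdiff, Set.mem_union]
      tauto
    rwa [e] at h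

end LinkDiagram

/-- The rows of twists of the Conway diagram, between the strands `1, 2` (when `mid` holds) and
between the strands `0, 1` in turn. The twists of the two kinds of rows have opposite handedness
as crossings of vertical strands, so that the diagram is alternating when all entries of the list
are positive. -/
def conwayTwists : Bool → List ℤ → List Layer
  | _, [] => []
  | mid, a :: as =>
    List.replicate a.natAbs
      (Layer.cross (if mid then 1 else 0) (if mid then decide (0 < a) else decide (a < 0))) ++
    conwayTwists (!mid) as

/-- The two caps at the top of the Conway diagram: they join the strands `0, 1` and `2, 3` if the
last row of twists lies between the strands `1, 2` (an odd number of rows), and the strands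
`1, 2` and `0, 3` otherwise. -/
def conwayCaps (j : ℕ) : List Layer :=
  if Odd j then [Layer.cap 0, Layer.cap 0] else [Layer.cap 1, Layer.cap 0]

theorem widthAfter_append (m : ℕ) (l l' : List Layer) :
    widthAfter m (l ++ l') = (widthAfter m l).bind fun k => widthAfter k l' := by
  induction l generalizing m with
  | nil => rfl
  | cons L l ih =>
    simp only [List.cons_append, widthAfter]
    split_ifs
    · exact ih _
    · rfl

theorem widthAfter_replicate_cross (i : ℕ) (hi : i + 2 ≤ 4) (b : Bool) (k : ℕ) :
    widthAfter 4 (List.replicate k (Layer.cross i b)) = some 4 := by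
  induction k with
  | zero => rfl
  | succ k ih =>
    simpa [List.replicate_succ, widthAfter, Layer.cross, Piece.inputs, Piece.outputs, hi] using ih

theorem widthAfter_conwayTwists (mid : Bool) (c : List ℤ) :
    widthAfter 4 (conwayTwists mid c) = some 4 := by
  induction c generalizing mid with
  | nil => rfl
  | cons a c ih =>
    rw [conwayTwists, widthAfter_append, widthAfter_replicate_cross _ (by cases mid <;> simp)]
    exact ih _

/-- The standard diagram with Conway notation `(c₁, …, cⱼ)`, drawn as a 4-plat: two cups create
the strands `0, 1` and `2, 3`, then rows of `c₁`, …, `cⱼ` twists follow, alternately between the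
two middle strands `1, 2` and the two left strands `0, 1`, and two caps close the diagram. -/
def conwayDiagram (c : List ℤ) : LinkDiagram where
  layers := [Layer.cup 0, Layer.cup 2] ++ conwayTwists true c ++ conwayCaps c.length
  closed := by
    have h : widthAfter 0 [Layer.cup 0, Layer.cup 2] = some 4 := rfl
    rw [widthAfter_append, widthAfter_append, h, Option.bind_some, widthAfter_conwayTwists,
      Option.bind_some, conwayCaps]
    split_ifs <;> rfl

/-! A U-independent unknotting set `I` is maximal: inserting a crossing `e` and then removing `{e}`
gives back the unknotting set `I`. In a matroid no independent set can have more elements than a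
maximal one, so each negative statement needs only such an `I` and a U-independent set `J` with more
crossings (`not_isMatroid_of_encard_lt`). In (b) the U-independent sets are exactly those with at
most `n` crossings, which is a uniform matroid.

U-independence requires showing that many switched diagrams are knotted. This is done with Fox
colourings, counted layer by layer and shown invariant under the local moves
(`stackCount_localMove`). In a Conway diagram every row acts on a pair of colour differences by a
transvection whose parameter is the number of twists left after switching, so a single integer, the
determinant, controls the colourings. If its absolute value `m` is at least `2`, there are `m ^ 2`
colourings in `ZMod m`, whereas an unknot has `m` (`not_isUnknot_of_two_le_capState`).
U-independence thus becomes an inequality for every proper subset of `W`.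

That a set does unknot is shown by explicit Reidemeister reductions to the circle. The unknotting
sets used are: for `(2n, 2)`, one crossing of the last row; for `(2n+1, 1, 2n)`, the middle crossing
and `n` crossings of the first row; for `(2n+1, 2, -2, …)`, one crossing in each row `2`. The larger
sets `J` lie in the first row, the last row and the first row respectively. -/

namespace Layer

@[simp] theorem switch_cup (i : ℕ) : (cup i).switch = cup i := rfl

@[simp] theorem switch_cap (i : ℕ) : (cap i).switch = cap i := rfl

@[simp] theorem switch_cross (i : ℕ) (b : Bool) : (cross i b).switch = cross i (!b) := rfl

end Layer

/-! ### Fox colourings -/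

section Coloring

variable {A : Type*}

/-- Insert two strands of colour `a` at the positions `i` and `i + 1`. -/
def insertPair (i : ℕ) (a : A) (x : ℕ → A) (k : ℕ) : A :=
  if k < i then x k else if k < i + 2 then a else x (k - 2)

/-- Remove the strands at the positions `i` and `i + 1`. -/
def removePair (i : ℕ) (x : ℕ → A) (k : ℕ) : A :=
  if k < i then x k else x (k + 2)

theorem insertPair_of_lt {i k : ℕ} (h : k < i) (a : A) (x : ℕ → A) : insertPair i a x k = x k :=
  if_pos h

theorem insertPair_new {i k : ℕ} (h : i ≤ k) (h' : k < i + 2) (a : A) (x : ℕ → A) :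
    insertPair i a x k = a := by
  rw [insertPair, if_neg (by omega), if_pos h']

theorem insertPair_of_ge {i k : ℕ} (h : i + 2 ≤ k) (a : A) (x : ℕ → A) :
    insertPair i a x k = x (k - 2) := by
  rw [insertPair, if_neg (by omega), if_neg (by omega)]

theorem removePair_of_lt {i k : ℕ} (h : k < i) (x : ℕ → A) : removePair i x k = x k :=
  if_pos h

theorem removePair_of_ge {i k : ℕ} (h : i ≤ k) (x : ℕ → A) : removePair i x k = x (k + 2) :=
  if_neg (by omega)

theorem insertPair_insertPair {i k : ℕ} (h : i ≤ k) (a a' : A) (x : ℕ → A) :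
    insertPair (k + 2) a' (insertPair i a x) = insertPair i a (insertPair k a' x) := by
  funext j
  simp only [insertPair]
  split_ifs <;> first | rfl | omega

theorem removePair_insertPair {i k : ℕ} (h : i ≤ k) (a : A) (x : ℕ → A) :
    removePair (k + 2) (insertPair i a x) = insertPair i a (removePair k x) := by
  funext j
  simp only [insertPair, removePair]
  split_ifs <;> first | rfl | omega | (congr 1; omega)

theorem insertPair_removePair {i k : ℕ} (h : i ≤ k) (a : A) (x : ℕ → A) :
    insertPair k a (removePair i x) = removePair i (insertPair (k + 2) a x) := by
  funext j
  simp only [insertPair, removePair]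
  split_ifs <;> first | rfl | omega | (congr 1; omega)

theorem removePair_removePair {i k : ℕ} (h : i ≤ k) (x : ℕ → A) :
    removePair k (removePair i x) = removePair i (removePair (k + 2) x) := by
  funext j
  simp only [removePair]
  split_ifs <;> first | rfl | omega

variable [AddCommGroup A]

/-- The colours above a crossing of the strands `i` and `i + 1`: the over-strand keeps its colour,
and the colour of the under-strand is reflected in it. -/
def crossPair (i : ℕ) (b : Bool) (x : ℕ → A) (k : ℕ) : A :=
  if k = i then (if b then x i + x i - x (i + 1) else x (i + 1))
  else if k = i + 1 then (if b then x i else x (i + 1) + x (i + 1) - x i)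
  else x k

theorem crossPair_left {i k : ℕ} (h : k = i) (b : Bool) (x : ℕ → A) :
    crossPair i b x k = if b then x i + x i - x (i + 1) else x (i + 1) :=
  if_pos h

theorem crossPair_right {i k : ℕ} (h : k = i + 1) (b : Bool) (x : ℕ → A) :
    crossPair i b x k = if b then x i else x (i + 1) + x (i + 1) - x i := by
  rw [crossPair, if_neg (by omega), if_pos h]

theorem crossPair_of_ne {i k : ℕ} (h : k ≠ i) (h' : k ≠ i + 1) (b : Bool) (x : ℕ → A) :
    crossPair i b x k = x k := by
  rw [crossPair, if_neg h, if_neg h']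

theorem crossPair_insertPair {i k : ℕ} (h : i ≤ k) (b : Bool) (a : A) (x : ℕ → A) :
    crossPair (k + 2) b (insertPair i a x) = insertPair i a (crossPair k b x) := by
  have h1 : insertPair i a x (k + 2) = x k := insertPair_of_ge (by omega) _ _
  have h2 : insertPair i a x (k + 2 + 1) = x (k + 1) := insertPair_of_ge (by omega) _ _
  funext j
  simp only [crossPair, h1, h2]
  simp only [insertPair, crossPair]
  split_ifs <;> first | rfl | omega

theorem crossPair_removePair {i k : ℕ} (h : i ≤ k) (b : Bool) (x : ℕ → A) :
    crossPair k b (removePair i x) = removePair i (crossPair (k + 2) b x) := by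
  have h1 : removePair i x k = x (k + 2) := removePair_of_ge (by omega) _
  have h2 : removePair i x (k + 1) = x (k + 2 + 1) := removePair_of_ge (by omega) _
  funext j
  simp only [crossPair, h1, h2]
  simp only [removePair, crossPair]
  split_ifs <;> first | rfl | omega

theorem insertPair_crossPair {i k : ℕ} (h : i + 2 ≤ k) (b : Bool) (a : A) (x : ℕ → A) :
    insertPair k a (crossPair i b x) = crossPair i b (insertPair k a x) := by
  have h1 : insertPair k a x i = x i := insertPair_of_lt (by omega) _ _
  have h2 : insertPair k a x (i + 1) = x (i + 1) := insertPair_of_lt (by omega) _ _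
  funext j
  simp only [crossPair, h1, h2]
  simp only [insertPair, crossPair]
  split_ifs <;> first | rfl | omega

theorem removePair_crossPair {i k : ℕ} (h : i + 2 ≤ k) (b : Bool) (x : ℕ → A) :
    removePair k (crossPair i b x) = crossPair i b (removePair k x) := by
  have h1 : removePair k x i = x i := removePair_of_lt (by omega) _
  have h2 : removePair k x (i + 1) = x (i + 1) := removePair_of_lt (by omega) _
  funext j
  simp only [crossPair, h1, h2]
  simp only [removePair, crossPair]
  split_ifs <;> first | rfl | omega

theorem crossPair_crossPair {i k : ℕ} (h : i + 2 ≤ k) (b c : Bool) (x : ℕ → A) :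
    crossPair k c (crossPair i b x) = crossPair i b (crossPair k c x) := by
  funext j
  obtain hj | hj | hj | hj | hj : j = i ∨ j = i + 1 ∨ j = k ∨ j = k + 1 ∨
    (j ≠ i ∧ j ≠ i + 1 ∧ j ≠ k ∧ j ≠ k + 1) := by omega
  all_goals simp (disch := omega) only [crossPair_left, crossPair_right, crossPair_of_ne]

variable [Fintype A] [DecidableEq A]

/-- The contribution `n` of a cap joining strands of the colours `a` and `b`. -/
def capWeight (a b : A) (n : ℕ) : ℕ := if a = b then n else 0

/-- Given the number `f x` of colourings of the part above a layer that extend the colours `x`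
at its bottom, the number of colourings of the part including the layer. -/
def layerCount : Layer → ((ℕ → A) → ℕ) → (ℕ → A) → ℕ
  | ⟨Piece.cup, i⟩, f, x => ∑ a, f (insertPair i a x)
  | ⟨Piece.cap, i⟩, f, x => capWeight (x i) (x (i + 1)) (f (removePair i x))
  | ⟨Piece.cross b, i⟩, f, x => f (crossPair i b x)

/-- The number of colourings of a stack of layers, weighted by `f` at the top, as a function of the
colours at the bottom. -/
def stackCount (l : List Layer) (f : (ℕ → A) → ℕ) : (ℕ → A) → ℕ :=
  l.foldr layerCount f

theorem stackCount_append (l l' : List Layer) (f : (ℕ → A) → ℕ) :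
    stackCount (l ++ l') f = stackCount l (stackCount l' f) := by
  simp [stackCount]

/-- The two pieces act on disjoint groups of strands, so their operations commute once positions are
shifted by the strands that `p` creates or removes. The nine cases are the pairs of kinds of pieces.
-/
theorem stackCount_exchange (p q : Piece) (i k : ℕ) (f : (ℕ → A) → ℕ) :
    stackCount [⟨p, i⟩, ⟨q, i + p.outputs + k⟩] f =
      stackCount [⟨q, i + p.inputs + k⟩, ⟨p, i⟩] f := by
  funext x
  have hik : i ≤ i + k := Nat.le_add_right i k
  have hik' : i + 2 ≤ i + k + 2 := by omega
  rcases p with _ | _ | b <;> rcases q with _ | _ | c <;>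
    simp only [stackCount, List.foldr, layerCount, Piece.inputs, Piece.outputs, Nat.add_zero,
      Nat.add_right_comm i 2 k]
  · rw [Finset.sum_comm]
    simp only [insertPair_insertPair hik]
  · have h1 (a : A) : insertPair i a x (i + k + 2) = x (i + k) := insertPair_of_ge (by omega) _ _
    have h2 (a : A) : insertPair i a x (i + k + 2 + 1) = x (i + k + 1) :=
      insertPair_of_ge (by omega) _ _
    simp_rw [h1, h2, removePair_insertPair hik]
    unfold capWeight
    split_ifs
    · rfl
    · simp
  · simp only [crossPair_insertPair hik]
  · have h1 (a : A) : insertPair (i + k + 2) a x i = x i := insertPair_of_lt (by omega) _ _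
    have h2 (a : A) : insertPair (i + k + 2) a x (i + 1) = x (i + 1) :=
      insertPair_of_lt (by omega) _ _
    simp_rw [h1, h2, insertPair_removePair hik]
    unfold capWeight
    split_ifs
    · rfl
    · simp
  · have h1 : removePair i x (i + k) = x (i + k + 2) := removePair_of_ge (by omega) _
    have h2 : removePair i x (i + k + 1) = x (i + k + 2 + 1) := removePair_of_ge (by omega) _
    have h3 : removePair (i + k + 2) x i = x i := removePair_of_lt (by omega) _
    have h4 : removePair (i + k + 2) x (i + 1) = x (i + 1) := removePair_of_lt (by omega) _
    rw [h1, h2, h3, h4, removePair_removePair hik]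
    unfold capWeight
    split_ifs <;> rfl
  · have h1 : crossPair (i + k + 2) c x i = x i := crossPair_of_ne (by omega) (by omega) _ _
    have h2 : crossPair (i + k + 2) c x (i + 1) = x (i + 1) :=
      crossPair_of_ne (by omega) (by omega) _ _
    rw [h1, h2, crossPair_removePair hik]
  · simp only [insertPair_crossPair hik']
  · have h1 : crossPair i b x (i + k + 2) = x (i + k + 2) :=
      crossPair_of_ne (by omega) (by omega) _ _
    have h2 : crossPair i b x (i + k + 2 + 1) = x (i + k + 2 + 1) :=
      crossPair_of_ne (by omega) (by omega) _ _
    rw [h1, h2, removePair_crossPair hik']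
  · rw [crossPair_crossPair hik']

/-- Since the weight `f` at the top and the colours at the bottom are arbitrary, invariance of this
small piece implies invariance inside any diagram. Each case is the usual bijection between
colourings before and after the move. -/
theorem stackCount_localMove {l l' : List Layer} (h : LocalMove l l') (f : (ℕ → A) → ℕ) :
    stackCount l f = stackCount l' f := by
  funext x
  induction h with
  | exchange p q i k => rw [stackCount_exchange]
  | zigzag_left i =>
    simp only [stackCount, List.foldr, layerCount, Layer.cup, Layer.cap]
    have h1 (a : A) : insertPair i a x (i + 1) = a := insertPair_new (by omega) (by omega) _ _
    have h2 (a : A) : insertPair i a x (i + 1 + 1) = x i := insertPair_of_ge (by omega) _ _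
    simp_rw [h1, h2, capWeight]
    rw [Finset.sum_ite_eq' Finset.univ (x i) fun a => f (removePair (i + 1) (insertPair i a x)),
      if_pos (Finset.mem_univ _)]
    refine congrArg f (funext fun j => ?_)
    simp only [removePair, insertPair]
    split_ifs <;> first | rfl | omega | (congr 1; omega)
  | zigzag_right i =>
    simp only [stackCount, List.foldr, layerCount, Layer.cup, Layer.cap]
    have h1 (a : A) : insertPair (i + 1) a x (i + 1) = a := insertPair_new (by omega) (by omega) _ _
    have h2 (a : A) : insertPair (i + 1) a x i = x i := insertPair_of_lt (by omega) _ _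
    simp_rw [h1, h2, capWeight]
    rw [Finset.sum_ite_eq Finset.univ (x i) fun a => f (removePair i (insertPair (i + 1) a x)),
      if_pos (Finset.mem_univ _)]
    refine congrArg f (funext fun j => ?_)
    simp only [removePair, insertPair]
    split_ifs <;> first | rfl | omega | (congr 1; omega)
  | slide_cap i b =>
    simp only [stackCount, List.foldr, layerCount, Layer.cross, Layer.cap]
    have e : crossPair i b x (i + 1) = crossPair i b x (i + 1 + 1) ↔
        crossPair (i + 1) (!b) x i = crossPair (i + 1) (!b) x (i + 1) := by
      simp (disch := omega) only [crossPair_left, crossPair_right, crossPair_of_ne]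
      cases b
      · simp only [Bool.false_eq_true, if_false, Bool.not_false, if_true]
        constructor <;> intro h
        · rw [← h]; abel
        · rw [h]; abel
      · simp
    by_cases hx : crossPair (i + 1) (!b) x i = crossPair (i + 1) (!b) x (i + 1)
    · rw [capWeight, capWeight, if_pos hx, if_pos (e.2 hx)]
      refine congrArg f (funext fun j => ?_)
      obtain hj | rfl | hj : j < i ∨ j = i ∨ i < j := by omega
      · simp (disch := omega) only [removePair_of_lt, crossPair_of_ne]
      · simp (disch := omega) only [crossPair_left, crossPair_of_ne] at hx
        simp (disch := omega) only [removePair_of_lt, removePair_of_ge, crossPair_left,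
          crossPair_right]
        cases b
        · simp
        · simp_all
      · simp (disch := omega) only [removePair_of_ge, crossPair_of_ne]
    · rw [capWeight, capWeight, if_neg hx, if_neg (mt e.1 hx)]
  | slide_cup i b =>
    simp only [stackCount, List.foldr, layerCount, Layer.cross, Layer.cup]
    -- If the cup passes over the strand of colour `x i`, its colour `a` is unaffected; if it passes
    -- under, `a` is reflected to `2 x i - a`.
    refine Fintype.sum_equiv (if b then Equiv.refl A else Equiv.subLeft (x i + x i)) _ _
      fun a => congrArg f (funext fun j => ?_)
    obtain hj | rfl | rfl | rfl | hj : j < i ∨ j = i ∨ j = i + 1 ∨ j = i + 1 + 1 ∨ i + 3 ≤ j := by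
      omega
    all_goals
      simp (disch := omega) only [crossPair_left, crossPair_right, crossPair_of_ne,
        insertPair_of_lt, insertPair_new, insertPair_of_ge]
    all_goals cases b <;> simp
  | reidemeister_one_cap i b =>
    simp only [stackCount, List.foldr, layerCount, Layer.cross, Layer.cap]
    have e : crossPair i b x i = crossPair i b x (i + 1) ↔ x i = x (i + 1) := by
      simp (disch := omega) only [crossPair_left, crossPair_right]
      cases b
      · simp only [Bool.false_eq_true, if_false]
        rw [eq_sub_iff_add_eq, add_left_cancel_iff]
      · simp only [if_true]
        rw [sub_eq_iff_eq_add, add_left_cancel_iff]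
    by_cases hx : x i = x (i + 1)
    · rw [capWeight, capWeight, if_pos hx, if_pos (e.2 hx)]
      refine congrArg f (funext fun j => ?_)
      obtain hj | hj : j < i ∨ i ≤ j := by omega
      all_goals
        simp (disch := omega) only [crossPair_of_ne, removePair_of_lt, removePair_of_ge]
    · rw [capWeight, capWeight, if_neg hx, if_neg (mt e.1 hx)]
  | reidemeister_one_cup i b =>
    simp only [stackCount, List.foldr, layerCount, Layer.cross, Layer.cup]
    refine Finset.sum_congr rfl fun a _ => congrArg f (funext fun j => ?_)
    obtain hj | rfl | rfl : (j ≠ i ∧ j ≠ i + 1) ∨ j = i ∨ j = i + 1 := by omega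
    all_goals
      simp (disch := omega) only [crossPair_left, crossPair_right, crossPair_of_ne, insertPair_new]
    all_goals cases b <;> simp
  | reidemeister_two i b =>
    simp only [stackCount, List.foldr, layerCount, Layer.cross]
    refine congrArg f (funext fun j => ?_)
    obtain hj | rfl | rfl : (j ≠ i ∧ j ≠ i + 1) ∨ j = i ∨ j = i + 1 := by omega
    all_goals
      simp (disch := omega) only [crossPair_left, crossPair_right, crossPair_of_ne]
    all_goals cases b <;> simp
  | reidemeister_three i a b c h =>
    simp only [stackCount, List.foldr, layerCount, Layer.cross]
    refine congrArg f (funext fun j => ?_)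
    obtain hj | rfl | rfl | rfl :
      (j ≠ i ∧ j ≠ i + 1 ∧ j ≠ i + 1 + 1) ∨ j = i ∨ j = i + 1 ∨ j = i + 1 + 1 := by omega
    all_goals
      simp (disch := omega) only [crossPair_left, crossPair_right, crossPair_of_ne]
    all_goals
      cases a <;> cases b <;> cases c <;> simp at h <;>
        simp only [Bool.false_eq_true, if_false, if_true] <;> abel

/-- The number of Fox colourings of a stack of layers without free ends. -/
def colorCount (A : Type*) [AddCommGroup A] [Fintype A] [DecidableEq A] (l : List Layer) : ℕ :=
  stackCount l (fun _ => 1) (0 : ℕ → A)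

theorem LinkDiagram.Isotopic.colorCount_eq {D D' : LinkDiagram} (h : D.Isotopic D') :
    colorCount A D.layers = colorCount A D'.layers := by
  induction h with
  | rel D D' h =>
    obtain ⟨below, above, x, y, hxy, h1, h2⟩ := h
    simp only [colorCount, h1, h2, stackCount_append, stackCount_localMove hxy]
  | refl => rfl
  | symm _ _ _ ih => exact ih.symm
  | trans _ _ _ _ _ ih ih' => exact ih.trans ih'

theorem LinkDiagram.IsUnknot.colorCount_eq {D : LinkDiagram} (h : D.IsUnknot) :
    colorCount A D.layers = Fintype.card A := by
  rw [Isotopic.colorCount_eq h]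
  simp [circle, colorCount, stackCount, layerCount, capWeight, Layer.cup, Layer.cap, insertPair]

end Coloring

/-! ### The determinant of a stack of twists -/

/-- The sign of a crossing of two vertical strands. -/
def twistSign (b : Bool) : ℤ := if b then 1 else -1

/-- How a layer changes the two differences `(x₁ - x₀, x₂ - x₁)` of the colours of the strands
`0, 1, 2`. -/
def twistState (s : ℤ × ℤ) : Layer → ℤ × ℤ
  | ⟨Piece.cross b, 0⟩ => (s.1, s.2 + twistSign b * s.1)
  | ⟨Piece.cross b, 1⟩ => (s.1 - twistSign b * s.2, s.2)
  | _ => s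

@[simp] theorem twistState_cross_zero (s : ℤ × ℤ) (b : Bool) :
    twistState s (Layer.cross 0 b) = (s.1, s.2 + twistSign b * s.1) := rfl

@[simp] theorem twistState_cross_one (s : ℤ × ℤ) (b : Bool) :
    twistState s (Layer.cross 1 b) = (s.1 - twistSign b * s.2, s.2) := rfl

/-- A layer with a crossing of the strands `0, 1` or `1, 2`. -/
def Layer.IsTwist (L : Layer) : Prop := ∃ b, L = cross 0 b ∨ L = cross 1 b

section Coloring

variable {A : Type*} [AddCommGroup A]

/-- The colours of four strands are determined by the first one, by `d`, and by the state `s`. -/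
def HasState (d : A) (s : ℤ × ℤ) (x : ℕ → A) : Prop :=
  x 1 - x 0 = s.1 • d ∧ x 2 - x 1 = s.2 • d ∧ x 0 + x 2 = x 1 + x 3

/-- A crossing preserves the difference of the two colours entering it, hence also the alternating
sum of all four colours; only the difference to the neighbouring strand changes. -/
theorem HasState.crossPair_zero {d : A} {s : ℤ × ℤ} {x : ℕ → A} (h : HasState d s x) (b : Bool) :
    HasState d (twistState s (Layer.cross 0 b)) (crossPair 0 b x) := by
  obtain ⟨h1, h2, h3⟩ := h
  refine ⟨?_, ?_, ?_⟩ <;>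
    simp only [crossPair_left, crossPair_right, crossPair_of_ne, twistState_cross_zero, twistSign,
      ne_eq, OfNat.ofNat_ne_zero, OfNat.ofNat_ne_one, not_false_eq_true, zero_add, add_smul,
      mul_smul, ← h1, ← h2] <;>
    cases b <;>
    simp only [Bool.false_eq_true, if_false, if_true, neg_smul, one_smul]
  any_goals abel1
  · rw [← sub_eq_zero] at h3 ⊢; rw [← h3]; abel
  · rw [← sub_eq_zero] at h3 ⊢; rw [← h3]; abel

theorem HasState.crossPair_one {d : A} {s : ℤ × ℤ} {x : ℕ → A} (h : HasState d s x) (b : Bool) :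
    HasState d (twistState s (Layer.cross 1 b)) (crossPair 1 b x) := by
  obtain ⟨h1, h2, h3⟩ := h
  have e0 : crossPair 1 b x 0 = x 0 := crossPair_of_ne (by omega) (by omega) _ _
  have e1 : crossPair 1 b x 1 = if b then x 1 + x 1 - x 2 else x 2 := crossPair_left rfl _ _
  have e2 : crossPair 1 b x 2 = if b then x 1 else x 2 + x 2 - x 1 := crossPair_right rfl _ _
  have e3 : crossPair 1 b x 3 = x 3 := crossPair_of_ne (by omega) (by omega) _ _
  refine ⟨?_, ?_, ?_⟩ <;>
    simp only [e0, e1, e2, e3, twistState_cross_one, twistSign, sub_smul, mul_smul, ← h1, ← h2] <;>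
    cases b <;>
    simp only [Bool.false_eq_true, if_false, if_true, neg_smul, one_smul]
  any_goals abel1
  · rw [← sub_eq_zero] at h3 ⊢; rw [← h3]; abel
  · rw [← sub_eq_zero] at h3 ⊢; rw [← h3]; abel

variable [Fintype A] [DecidableEq A]

/-- Crossings leave no choice: the colours at the bottom determine those at the top, and the state
follows them. -/
theorem HasState.exists_stackCount_eq {d : A} {w : List Layer} (hw : ∀ L ∈ w, L.IsTwist) :
    ∀ {s : ℤ × ℤ} {x : ℕ → A}, HasState d s x →
      ∃ y, HasState d (w.foldl twistState s) y ∧ ∀ f, stackCount w f x = f y := by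
  induction w with
  | nil => exact fun {_ x} hx => ⟨x, hx, fun _ => rfl⟩
  | cons L w ih =>
    intro s x hx
    have ih' := @ih fun L' hL' => hw L' (List.mem_cons_of_mem _ hL')
    obtain ⟨b, rfl | rfl⟩ := hw L List.mem_cons_self
    · exact ih' (hx.crossPair_zero b)
    · exact ih' (hx.crossPair_one b)

/-- The component of the state that has to vanish for a colouring to extend over the caps. -/
def capState (j : ℕ) (s : ℤ × ℤ) : ℤ := if Odd j then s.1 else s.2

/-- Because the alternating sum of the four colours vanishes, the condition at one cap implies the
condition at the other. -/
theorem HasState.stackCount_conwayCaps {d : A} {s : ℤ × ℤ} {x : ℕ → A} (h : HasState d s x) {j : ℕ}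
    (hj : capState j s • d = 0) : stackCount (conwayCaps j) (fun _ => 1) x = 1 := by
  obtain ⟨h1, h2, h3⟩ := h
  unfold capState at hj
  unfold conwayCaps
  split_ifs at hj ⊢
  · have e1 : x 0 = x 1 := by rw [hj, sub_eq_zero] at h1; exact h1.symm
    have e2 : x 2 = x 3 := by rwa [e1, add_left_cancel_iff] at h3
    simp [stackCount, layerCount, Layer.cap, capWeight, removePair, e1, e2]
  · have e1 : x 1 = x 2 := by rw [hj, sub_eq_zero] at h2; exact h2.symm
    have e2 : x 0 = x 3 := by rwa [e1, add_comm (x 2), add_right_cancel_iff] at h3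
    simp [stackCount, layerCount, Layer.cap, capWeight, removePair, e1, e2]

end Coloring

/-- A closed diagram with more than one Fox colouring up to translation is not an unknot. -/
theorem not_isUnknot_of_two_le_capState {D : LinkDiagram} {w : List Layer} {j : ℕ}
    (hD : D.layers = [Layer.cup 0, Layer.cup 2] ++ w ++ conwayCaps j) (hw : ∀ L ∈ w, L.IsTwist)
    (h : 2 ≤ |capState j (w.foldl twistState (0, 1))|) : ¬ D.IsUnknot := by
  intro hu
  set δ := capState j (w.foldl twistState (0, 1)) with hδ
  have hm : 2 ≤ δ.natAbs := by rw [Int.abs_eq_natAbs] at h; exact_mod_cast h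
  have : NeZero δ.natAbs := ⟨by omega⟩
  have hc := hu.colorCount_eq (A := ZMod δ.natAbs)
  -- Modulo `δ` the cap condition is automatic, so every choice of colours `p, q` at the two cups,
  -- with `d = q - p` and initial state `(0, 1)`, extends in exactly one way.
  have key (p q : ZMod δ.natAbs) :
      stackCount (w ++ conwayCaps j) (fun _ => 1) (insertPair 2 q (insertPair 0 p 0)) = 1 := by
    have h0 : HasState (q - p) (0, 1) (insertPair 2 q (insertPair 0 p 0)) := by
      simp [HasState, insertPair]
    obtain ⟨y, hy, hf⟩ := h0.exists_stackCount_eq hw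
    rw [stackCount_append, hf]
    refine hy.stackCount_conwayCaps ?_
    rw [← hδ, zsmul_eq_mul, (ZMod.intCast_zmod_eq_zero_iff_dvd δ _).2 (by simp), zero_mul]
  rw [hD, List.append_assoc] at hc
  have : colorCount (ZMod δ.natAbs) ([Layer.cup 0, Layer.cup 2] ++ (w ++ conwayCaps j)) =
      δ.natAbs * δ.natAbs := by
    rw [colorCount, stackCount_append]
    simp only [stackCount, List.foldr_cons, List.foldr_nil, layerCount, Layer.cup]
    simp only [stackCount] at key
    simp only [key]
    simp [ZMod.card]
  rw [this, ZMod.card] at hc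
  nlinarith

/-! ### Simplifying stacks of layers -/

/-- A stack of layers can be turned into another one by local moves (without inverses). -/
def Reduces : List Layer → List Layer → Prop :=
  Relation.ReflTransGen fun l l' =>
    ∃ below above x y, LocalMove x y ∧ l = below ++ x ++ above ∧ l' = below ++ y ++ above

namespace Reduces

theorem refl (l : List Layer) : Reduces l l := Relation.ReflTransGen.refl

theorem trans {l l' l'' : List Layer} (h : Reduces l l') (h' : Reduces l' l'') : Reduces l l'' :=
  Relation.ReflTransGen.trans h h'

theorem of_localMove {x y : List Layer} (h : LocalMove x y) : Reduces x y :=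
  Relation.ReflTransGen.single ⟨[], [], x, y, h, by simp, by simp⟩

theorem append {l l' : List Layer} (h : Reduces l l') (a b : List Layer) :
    Reduces (a ++ l ++ b) (a ++ l' ++ b) := by
  refine Relation.ReflTransGen.lift (fun l => a ++ l ++ b) ?_ _ _ h
  rintro _ _ ⟨below, above, x, y, hxy, rfl, rfl⟩
  exact ⟨a ++ below, above ++ b, x, y, hxy, by simp, by simp⟩

theorem append_left {l l' : List Layer} (h : Reduces l l') (a : List Layer) :
    Reduces (a ++ l) (a ++ l') := by
  simpa using h.append a []

theorem append_right {l l' : List Layer} (h : Reduces l l') (b : List Layer) :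
    Reduces (l ++ b) (l' ++ b) := by
  simpa using h.append [] b

end Reduces

/-- Ensures that the intermediate stacks of a reduction are closed diagrams. The converse fails,
since the empty side of a move fits even where the other side has too few strands; hence reductions
are directed. -/
theorem LocalMove.widthAfter_eq {x y : List Layer} (h : LocalMove x y) {m k : ℕ}
    (hx : widthAfter m x = some k) : widthAfter m y = some k := by
  induction h with
  | exchange p q i k =>
    rcases p with _ | _ | _ <;> rcases q with _ | _ | _ <;>
      simp only [widthAfter, Piece.inputs, Piece.outputs] at hx ⊢ <;>
      split_ifs at hx ⊢ <;> first | omega | (simp at hx ⊢; omega)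
  | reidemeister_three =>
    simp only [widthAfter, Layer.cross, Piece.inputs, Piece.outputs] at hx ⊢
    split_ifs at hx ⊢ <;> first | omega | (simp at hx ⊢; omega)
  | _ =>
    simp only [widthAfter, Layer.cross, Layer.cup, Layer.cap, Piece.inputs, Piece.outputs] at hx ⊢
    split_ifs at hx ⊢ <;> first | omega | (simp at hx ⊢; try omega)

theorem Reduces.isotopic {l l' : List Layer} (h : Reduces l l') :
    ∀ D D' : LinkDiagram, D.layers = l → D'.layers = l' → D.Isotopic D' := by
  induction h using Relation.ReflTransGen.head_induction_on with
  | refl =>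
    rintro ⟨l, hl⟩ ⟨l', hl'⟩ rfl h
    obtain rfl : l' = l := h
    exact Relation.EqvGen.refl _
  | head h _ ih =>
    obtain ⟨below, above, x, y, hxy, rfl, rfl⟩ := h
    intro D D' hD hD'
    have hc : widthAfter 0 (below ++ y ++ above) = some 0 := by
      have := D.closed
      rw [hD, List.append_assoc, widthAfter_append] at this
      obtain ⟨a, ha, h1⟩ := Option.bind_eq_some_iff.1 this
      rw [widthAfter_append] at h1
      obtain ⟨b, hb, h2⟩ := Option.bind_eq_some_iff.1 h1
      rw [List.append_assoc, widthAfter_append, ha, Option.bind_some, widthAfter_append,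
        hxy.widthAfter_eq hb, Option.bind_some, h2]
    exact (Relation.EqvGen.rel _ _ ⟨below, above, x, y, hxy, hD, rfl⟩).trans _ _ _
      (ih ⟨_, hc⟩ D' rfl hD')

theorem LinkDiagram.isUnknot_of_reduces {D : LinkDiagram}
    (h : Reduces D.layers [Layer.cup 0, Layer.cap 0]) : D.IsUnknot :=
  h.isotopic D circle rfl rfl

/-- A row of `e` twists of the strands `i` and `i + 1`; the sign of `e` is the sign of the
crossings. -/
def twistRow (i : ℕ) (e : ℤ) : List Layer :=
  List.replicate e.natAbs (Layer.cross i (decide (0 < e)))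

theorem twistRow_natCast (i n : ℕ) : twistRow i n = List.replicate n (Layer.cross i true) := by
  rcases n with _ | n
  · rfl
  · simp [twistRow, show (0 : ℤ) < n + 1 by omega, show (n + 1 : ℤ).natAbs = n + 1 by omega]

theorem twistRow_neg_natCast (i n : ℕ) :
    twistRow i (-n) = List.replicate n (Layer.cross i false) := by
  simp [twistRow, show ¬ (n : ℤ) < 0 by omega]

theorem reduces_cons_twistRow (i : ℕ) (b : Bool) (e : ℤ) :
    Reduces (Layer.cross i b :: twistRow i e) (twistRow i (twistSign b + e)) := by
  have cancel (b : Bool) (l : List Layer) :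
      Reduces (Layer.cross i b :: Layer.cross i (!b) :: l) l :=
    (Reduces.of_localMove (.reidemeister_two i b)).append_right l
  obtain ⟨n, rfl | rfl⟩ := e.eq_nat_or_neg
  · cases b
    · rcases n with _ | n
      · exact Reduces.refl _
      · rw [show twistSign false + ((n + 1 : ℕ) : ℤ) = n by simp [twistSign], twistRow_natCast,
          twistRow_natCast]
        exact cancel false _
    · rw [show twistSign true + (n : ℤ) = (n + 1 : ℕ) by simp [twistSign, add_comm],
        twistRow_natCast, twistRow_natCast]
      exact Reduces.refl _
  · cases b
    · rw [show twistSign false + -(n : ℤ) = -(n + 1 : ℕ) by simp [twistSign],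
        twistRow_neg_natCast, twistRow_neg_natCast]
      exact Reduces.refl _
    · rcases n with _ | n
      · exact Reduces.refl _
      · rw [show twistSign true + -((n + 1 : ℕ) : ℤ) = -n by simp [twistSign],
          twistRow_neg_natCast, twistRow_neg_natCast]
        exact cancel true _

theorem Reduces.replicate_append_twistRow (i : ℕ) (b : Bool) (n : ℕ) (e : ℤ) :
    Reduces (List.replicate n (Layer.cross i b) ++ twistRow i e)
      (twistRow i (twistSign b * n + e)) := by
  induction n with
  | zero => simpa using Reduces.refl _
  | succ n ih =>
    refine (ih.append_left [Layer.cross i b]).trans ?_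
    rw [show twistSign b * ((n + 1 : ℕ) : ℤ) + e = twistSign b + (twistSign b * n + e) by
      push_cast; ring]
    exact reduces_cons_twistRow i b _

theorem reduces_cup_replicate_cross (i : ℕ) (b : Bool) (n : ℕ) :
    Reduces (Layer.cup i :: List.replicate n (Layer.cross i b)) [Layer.cup i] := by
  induction n with
  | zero => exact Reduces.refl _
  | succ n ih =>
    exact ((Reduces.of_localMove (.reidemeister_one_cup i b)).append_right _).trans ih

theorem reduces_replicate_cross_cap (i : ℕ) (b : Bool) (n : ℕ) :
    Reduces (List.replicate n (Layer.cross i b) ++ [Layer.cap i]) [Layer.cap i] := by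
  induction n with
  | zero => exact Reduces.refl _
  | succ n ih =>
    exact (ih.append_left [Layer.cross i b]).trans
      (Reduces.of_localMove (.reidemeister_one_cap i b))

/-- One crossing of the two middle strands, closed up as in a Conway diagram with an odd number of
rows, is an unknot. -/
theorem reduces_single_crossing :
    Reduces ([Layer.cup 0, Layer.cup 2] ++ twistRow 1 1 ++ conwayCaps 1)
      [Layer.cup 0, Layer.cap 0] := by
  have h1 : Reduces [Layer.cup 0, Layer.cup 2] [Layer.cup 0, Layer.cup 0] :=
    .of_localMove (.exchange .cup .cup 0 0)
  -- Sliding the cup moves the crossing to the strands `0, 1`, where the cap above absorbs it; the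
  -- remaining zigzag straightens.
  have h2 : Reduces [Layer.cup 0, Layer.cross 1 true] [Layer.cup 1, Layer.cross 0 false] :=
    .of_localMove (.slide_cup 0 true)
  have h3 : Reduces [Layer.cross 0 false, Layer.cap 0] [Layer.cap 0] :=
    .of_localMove (.reidemeister_one_cap 0 false)
  have h4 : Reduces [Layer.cup 1, Layer.cap 0] [] := .of_localMove (.zigzag_right 0)
  exact (h1.append_right [Layer.cross 1 true, Layer.cap 0, Layer.cap 0]).trans <|
    (h2.append [Layer.cup 0] [Layer.cap 0, Layer.cap 0]).trans <|
    (h3.append [Layer.cup 0, Layer.cup 1] [Layer.cap 0]).trans <|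
    h4.append [Layer.cup 0] [Layer.cap 0]

/-! ### Switching crossings by their positions -/

/-- Switch the layers of a stack at the positions given by `P`. -/
def switchAt (P : ℕ → Bool) (l : List Layer) : List Layer :=
  l.mapIdx fun k L => if P k then L.switch else L

@[simp] theorem switchAt_nil (P : ℕ → Bool) : switchAt P [] = [] := rfl

@[simp] theorem switchAt_cons (P : ℕ → Bool) (L : Layer) (l : List Layer) :
    switchAt P (L :: l) =
      (if P 0 then L.switch else L) :: switchAt (fun k => P (k + 1)) l := by
  simp [switchAt, List.mapIdx_cons]

theorem switchAt_append (P : ℕ → Bool) (l l' : List Layer) :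
    switchAt P (l ++ l') = switchAt P l ++ switchAt (fun k => P (k + l.length)) l' := by
  simp [switchAt, List.mapIdx_append]

theorem switchAt_conwayCaps (P : ℕ → Bool) (j : ℕ) : switchAt P (conwayCaps j) = conwayCaps j := by
  unfold conwayCaps
  split_ifs <;> simp

theorem isTwist_switchAt {P : ℕ → Bool} {l : List Layer} (h : ∀ L ∈ l, L.IsTwist) :
    ∀ L ∈ switchAt P l, L.IsTwist := by
  induction l generalizing P with
  | nil => simp
  | cons L l ih =>
    simp only [List.forall_mem_cons] at h
    simp only [switchAt_cons, List.forall_mem_cons]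
    refine ⟨?_, ih h.2⟩
    obtain ⟨b, rfl | rfl⟩ := h.1 <;> split_ifs
    exacts [⟨!b, .inl rfl⟩, ⟨b, .inl rfl⟩, ⟨!b, .inr rfl⟩, ⟨b, .inr rfl⟩]

theorem twistSign_not (b : Bool) : twistSign (!b) = -twistSign b := by
  cases b <;> rfl

/-- The number of twists of a row of `n` crossings after switching, up to the common sign. -/
def netTwists (P : ℕ → Bool) (n : ℕ) : ℤ := n - 2 * Nat.count (fun k => P k) n

theorem netTwists_zero (P : ℕ → Bool) : netTwists P 0 = 0 := rfl

theorem netTwists_succ (P : ℕ → Bool) (n : ℕ) :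
    netTwists P (n + 1) = (if P 0 then -1 else 1) + netTwists (fun k => P (k + 1)) n := by
  unfold netTwists
  rw [Nat.count_succ']
  split_ifs <;> push_cast <;> ring

/-- Adjacent opposite crossings cancel by the second Reidemeister move, so only the number of
switched crossings in a row matters, not their places. -/
theorem reduces_switchAt_replicate (P : ℕ → Bool) (i n : ℕ) (b : Bool) :
    Reduces (switchAt P (List.replicate n (Layer.cross i b)))
      (twistRow i (twistSign b * netTwists P n)) := by
  induction n generalizing P with
  | zero => rw [netTwists_zero, mul_zero]; exact Reduces.refl _
  | succ n ih =>
    rw [List.replicate_succ, switchAt_cons, netTwists_succ, mul_add]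
    refine ((ih _).append_left [_]).trans ?_
    split_ifs
    · simpa [twistSign_not] using reduces_cons_twistRow i (!b) _
    · simpa using reduces_cons_twistRow i b _

/-- All crossings of a row act by powers of one transvection, so their exponents add up. -/
theorem foldl_twistState_switchAt_zero (P : ℕ → Bool) (n : ℕ) (b : Bool) (s : ℤ × ℤ) :
    (switchAt P (List.replicate n (Layer.cross 0 b))).foldl twistState s =
      (s.1, s.2 + twistSign b * netTwists P n * s.1) := by
  induction n generalizing P s with
  | zero => simp [netTwists_zero]
  | succ n ih =>
    rw [List.replicate_succ, switchAt_cons, netTwists_succ, List.foldl_cons, ih]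
    split_ifs <;> simp [twistSign_not] <;> ring

theorem foldl_twistState_switchAt_one (P : ℕ → Bool) (n : ℕ) (b : Bool) (s : ℤ × ℤ) :
    (switchAt P (List.replicate n (Layer.cross 1 b))).foldl twistState s =
      (s.1 - twistSign b * netTwists P n * s.2, s.2) := by
  induction n generalizing P s with
  | zero => simp [netTwists_zero]
  | succ n ih =>
    rw [List.replicate_succ, switchAt_cons, netTwists_succ, List.foldl_cons, ih]
    split_ifs <;> simp [twistSign_not] <;> ring

theorem count_mem_eq_card_filter (T : Finset ℕ) (o n : ℕ) :
    Nat.count (fun k => decide (k + o ∈ T)) n = {k ∈ T | o ≤ k ∧ k < o + n}.card := by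
  rw [Nat.count_eq_card_filter_range]
  refine Finset.card_bij (fun k _ => k + o) ?_ ?_ ?_
  · intro k hk
    simp only [Finset.mem_filter, Finset.mem_range, decide_eq_true_eq] at hk ⊢
    exact ⟨hk.2, by omega, by omega⟩
  · intro k _ k' _ h
    omega
  · intro k hk
    simp only [Finset.mem_filter, Finset.mem_range, decide_eq_true_eq] at hk ⊢
    exact ⟨k - o, ⟨by omega, by rw [Nat.sub_add_cancel hk.2.1]; exact hk.1⟩, by omega⟩

/-! ### Sets of crossings of Conway diagrams -/

theorem isTwist_conwayTwists (mid : Bool) (c : List ℤ) : ∀ L ∈ conwayTwists mid c, L.IsTwist := by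
  induction c generalizing mid with
  | nil => simp [conwayTwists]
  | cons a c ih =>
    intro L hL
    rw [conwayTwists, List.mem_append] at hL
    rcases hL with hL | hL
    · obtain rfl := (List.mem_replicate.1 hL).2
      cases mid
      · exact ⟨_, .inl rfl⟩
      · exact ⟨_, .inr rfl⟩
    · exact ih _ L hL

namespace LinkDiagram

instance (D : LinkDiagram) : Finite D.Crossing := by
  unfold Crossing
  infer_instance

variable {c : List ℤ}

theorem length_conwayDiagram_layers (c : List ℤ) :
    (conwayDiagram c).layers.length = 2 + (conwayTwists true c).length + 2 := by
  have h : (conwayCaps c.length).length = 2 := by unfold conwayCaps; split_ifs <;> rfl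
  simp [conwayDiagram, h]; omega

theorem isCrossing_conwayDiagram_iff {k : ℕ} (hk : k < (conwayDiagram c).layers.length) :
    ((conwayDiagram c).layers[k]).piece.IsCrossing ↔
      2 ≤ k ∧ k < 2 + (conwayTwists true c).length := by
  have hl := length_conwayDiagram_layers c
  constructor
  · intro h
    by_contra hcon
    obtain h2 | ⟨h2, h3⟩ : k < 2 ∨
      (2 + (conwayTwists true c).length ≤ k ∧ k < 2 + (conwayTwists true c).length + 2) := by omega
    · interval_cases k <;> exact h
    · have hcap : ∀ L ∈ conwayCaps c.length, ¬ L.piece.IsCrossing := by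
        unfold conwayCaps
        split_ifs <;> simp [Layer.cap, Piece.IsCrossing]
      simp only [conwayDiagram] at h
      rw [List.getElem_append_right (by simp; omega)] at h
      exact hcap _ (List.getElem_mem _) h
  · rintro ⟨h2, h3⟩
    simp only [conwayDiagram]
    rw [List.getElem_append_left (by simp; omega), List.getElem_append_right (by simp; omega)]
    obtain ⟨b, h | h⟩ := isTwist_conwayTwists true c _ (List.getElem_mem (n := k - 2) (by omega))
    all_goals
      simp only [List.length_cons, List.length_nil]
      rw [h]
      trivial

/-- The place of a crossing of a Conway diagram in the stack of twists. -/
def twistIndex (x : (conwayDiagram c).Crossing) : ℕ := x.1.val - 2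

theorem twistIndex_add_two (x : (conwayDiagram c).Crossing) : twistIndex x + 2 = x.1.val := by
  have := (isCrossing_conwayDiagram_iff x.1.isLt).1 x.2
  unfold twistIndex
  omega

theorem twistIndex_injective : Function.Injective (twistIndex (c := c)) := by
  intro x y h
  have hx := twistIndex_add_two x
  have hy := twistIndex_add_two y
  exact Subtype.ext (Fin.ext (by omega))

theorem exists_twistIndex_eq {k : ℕ} (hk : k < (conwayTwists true c).length) :
    ∃ x : (conwayDiagram c).Crossing, twistIndex x = k :=
  ⟨⟨⟨k + 2, by rw [length_conwayDiagram_layers]; omega⟩,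
    (isCrossing_conwayDiagram_iff _).2 ⟨by omega, by omega⟩⟩, rfl⟩

/-- The places in the stack of twists of the crossings in a set. -/
noncomputable def twistIndices (S : Set (conwayDiagram c).Crossing) : Finset ℕ :=
  (S.toFinite.image twistIndex).toFinset

theorem mem_twistIndices {S : Set (conwayDiagram c).Crossing} {k : ℕ} :
    k ∈ twistIndices S ↔ ∃ x ∈ S, twistIndex x = k := by
  simp [twistIndices]

theorem coe_twistIndices (S : Set (conwayDiagram c).Crossing) :
    (twistIndices S : Set ℕ) = twistIndex '' S := by
  simp [twistIndices]

theorem encard_twistIndices (S : Set (conwayDiagram c).Crossing) :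
    ((twistIndices S).card : ℕ∞) = S.encard := by
  rw [← Set.encard_coe_eq_coe_finsetCard, coe_twistIndices, twistIndex_injective.encard_image]

theorem twistIndices_ssubset {S T : Set (conwayDiagram c).Crossing} (h : S ⊂ T) :
    twistIndices S ⊂ twistIndices T := by
  rw [← Finset.coe_ssubset, coe_twistIndices, coe_twistIndices]
  exact twistIndex_injective.image_strictMono h

theorem twistIndices_preimage {T : Finset ℕ} (hT : ∀ k ∈ T, k < (conwayTwists true c).length) :
    twistIndices {x : (conwayDiagram c).Crossing | twistIndex x ∈ T} = T := by
  ext k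
  rw [mem_twistIndices]
  constructor
  · rintro ⟨x, hx, rfl⟩
    exact hx
  · intro hk
    obtain ⟨x, rfl⟩ := exists_twistIndex_eq (hT k hk)
    exact ⟨x, hk, rfl⟩

theorem switch_conwayDiagram_layers (S : Set (conwayDiagram c).Crossing) :
    ((conwayDiagram c).switch S).layers = [Layer.cup 0, Layer.cup 2] ++
      switchAt (fun k => decide (k ∈ twistIndices S)) (conwayTwists true c) ++
      conwayCaps c.length := by
  classical
  have h : ((conwayDiagram c).switch S).layers =
      switchAt (fun k => decide (∃ x ∈ S, x.1.val = k)) (conwayDiagram c).layers := by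
    refine List.ext_getElem (by simp [switch, switchLayers, switchAt]) fun k h1 h2 => ?_
    simp [switch, switchLayers, switchAt, Fin.ext_iff]
  rw [h]
  simp only [conwayDiagram, switchAt_append, switchAt_conwayCaps]
  congr 2
  · simp
  · congr 1
    funext k
    refine decide_eq_decide.2 ?_
    rw [mem_twistIndices]
    refine exists_congr fun x => and_congr_right fun _ => ?_
    have := twistIndex_add_two x
    simp only [List.length_cons, List.length_nil]
    omega

/-- The determinant of the diagram obtained from a Conway diagram by switching the crossings at the
places in `T`. -/
def switchedDet (c : List ℤ) (T : Finset ℕ) : ℤ :=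
  capState c.length
    ((switchAt (fun k => decide (k ∈ T)) (conwayTwists true c)).foldl twistState (0, 1))

theorem not_isUnknottingSet {S : Set (conwayDiagram c).Crossing}
    (h : 2 ≤ |switchedDet c (twistIndices S)|) : ¬ (conwayDiagram c).IsUnknottingSet S :=
  not_isUnknot_of_two_le_capState (switch_conwayDiagram_layers S)
    (isTwist_switchAt (isTwist_conwayTwists true c)) h

theorem isUnknottingSet_of_reduces {S : Set (conwayDiagram c).Crossing}
    (h : Reduces ([Layer.cup 0, Layer.cup 2] ++
      switchAt (fun k => decide (k ∈ twistIndices S)) (conwayTwists true c) ++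
      conwayCaps c.length) [Layer.cup 0, Layer.cap 0]) : (conwayDiagram c).IsUnknottingSet S :=
  isUnknot_of_reduces (by rwa [switch_conwayDiagram_layers])

/-- The sets `W \ S` with `S ⊆ W` non-empty are proper subsets of `W`, so it suffices to bound the
determinant on these. -/
theorem uIndependent_of_switchedDet {W : Set (conwayDiagram c).Crossing}
    (h : ∀ T ⊂ twistIndices W, 2 ≤ |switchedDet c T|) : (conwayDiagram c).UIndependent W := by
  intro S hS hne
  refine not_isUnknottingSet (h _ (twistIndices_ssubset ?_))
  refine ⟨Set.sdiff_subset, fun hW => ?_⟩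
  obtain ⟨x, hx⟩ := hne
  exact (hW (hS hx)).2 hx

/-- A U-independent unknotting set is maximal among the U-independent sets, so a larger
U-independent set is an obstruction to being a matroid. -/
theorem not_isMatroid_of_encard_lt {D : LinkDiagram} {I J : Set D.Crossing}
    (hI : D.UIndependent I) (hJ : D.UIndependent J) (hIJ : I.encard < J.encard)
    (hu : D.IsUnknottingSet I) : ¬ D.uSystem.IsMatroid := by
  rintro ⟨M, -, hM⟩
  obtain ⟨e, he, h⟩ := ((hM I).2 hI).augment ((hM J).2 hJ) hIJ
  refine (hM _).1 h {e} (by simp) (Set.singleton_nonempty e) ?_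
  rwa [Set.insert_sdiff_self_of_notMem he.2]

theorem not_isMatroid_of_switchedDet (I J : Finset ℕ)
    (hI : ∀ k ∈ I, k < (conwayTwists true c).length)
    (hJ : ∀ k ∈ J, k < (conwayTwists true c).length) (hIJ : I.card < J.card)
    (hIu : Reduces ([Layer.cup 0, Layer.cup 2] ++
      switchAt (fun k => decide (k ∈ I)) (conwayTwists true c) ++
      conwayCaps c.length) [Layer.cup 0, Layer.cap 0])
    (hId : ∀ T ⊂ I, 2 ≤ |switchedDet c T|) (hJd : ∀ T ⊂ J, 2 ≤ |switchedDet c T|) :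
    ¬ (conwayDiagram c).uSystem.IsMatroid := by
  rw [← twistIndices_preimage hI] at hId hIu
  rw [← twistIndices_preimage hJ] at hJd
  refine not_isMatroid_of_encard_lt (uIndependent_of_switchedDet hId)
    (uIndependent_of_switchedDet hJd) ?_ (isUnknottingSet_of_reduces hIu)
  rw [← encard_twistIndices, ← encard_twistIndices, twistIndices_preimage hI,
    twistIndices_preimage hJ]
  exact_mod_cast hIJ

end LinkDiagram

/-! ### Uniform matroids, and net twists of a row in terms of positions -/

namespace LinkDiagram

theorem isMatroid_of_uIndependent_iff_ncard_le {D : LinkDiagram} (n : ℕ)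
    (h : ∀ W : Set D.Crossing, D.UIndependent W ↔ W.ncard ≤ n) : D.uSystem.IsMatroid := by
  refine ⟨(IndepMatroid.ofFinite (Set.toFinite Set.univ) (fun W : Set D.Crossing => W.ncard ≤ n)
    (by simp) (fun I J hJ hIJ => (Set.ncard_le_ncard hIJ).trans hJ) ?_
    (fun I _ => Set.subset_univ I)).matroid, rfl, fun W => (h W).symm⟩
  intro I J hI hJ hIJ
  obtain ⟨e, heJ, heI⟩ := Set.exists_mem_notMem_of_ncard_lt_ncard hIJ
  refine ⟨e, heJ, heI, ?_⟩
  rw [Set.ncard_insert_of_notMem heI]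
  omega

theorem ncard_eq_card_twistIndices {c : List ℤ} (S : Set (conwayDiagram c).Crossing) :
    S.ncard = (twistIndices S).card := by
  rw [Set.ncard, ← encard_twistIndices, ENat.toNat_natCast]

theorem lt_of_mem_twistIndices {c : List ℤ} {S : Set (conwayDiagram c).Crossing} {k : ℕ}
    (hk : k ∈ twistIndices S) : k < (conwayTwists true c).length := by
  obtain ⟨x, _, rfl⟩ := mem_twistIndices.1 hk
  have h := ((isCrossing_conwayDiagram_iff x.1.isLt).1 x.2).2
  have := twistIndex_add_two x
  omega

theorem netTwists_mem (T : Finset ℕ) (o n : ℕ) :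
    netTwists (fun k => decide (k + o ∈ T)) n = n - 2 * {k ∈ T | o ≤ k ∧ k < o + n}.card := by
  rw [netTwists, count_mem_eq_card_filter]

theorem netTwists_eq_of_forall_notMem {T : Finset ℕ} {o n : ℕ}
    (h : ∀ k ∈ T, k < o ∨ o + n ≤ k) : netTwists (fun k => decide (k + o ∈ T)) n = n := by
  rw [netTwists_mem, Finset.filter_false_of_mem]
  · simp
  · intro k hk
    have := h k hk
    omega

theorem netTwists_eq_of_forall_mem {T : Finset ℕ} {o n : ℕ}
    (h : ∀ k ∈ T, o ≤ k ∧ k < o + n) :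
    netTwists (fun k => decide (k + o ∈ T)) n = n - 2 * T.card := by
  rw [netTwists_mem, Finset.filter_true_of_mem h]

/-! ### The diagrams `(2n+1)` -/

section OneRow

variable (n : ℕ)

theorem conwayTwists_odd :
    conwayTwists true [2 * (n : ℤ) + 1] =
      List.replicate (2 * n + 1) (Layer.cross 1 true) := by
  simp only [conwayTwists, List.append_nil, if_true]
  congr 2
  simp

theorem switchedDet_odd {T : Finset ℕ} (hT : ∀ k ∈ T, k < 2 * n + 1) :
    switchedDet [2 * (n : ℤ) + 1] T = 2 * T.card - (2 * n + 1) := by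
  have h := netTwists_eq_of_forall_mem (T := T) (o := 0) (n := 2 * n + 1) (by simpa using hT)
  simp only [add_zero] at h
  rw [switchedDet, conwayTwists_odd, foldl_twistState_switchAt_one, h]
  simp [capState, twistSign]

theorem isMatroid_conwayDiagram_odd : (conwayDiagram [2 * (n : ℤ) + 1]).uSystem.IsMatroid := by
  have hlt {S : Set (conwayDiagram [2 * (n : ℤ) + 1]).Crossing} :
      ∀ k ∈ twistIndices S, k < 2 * n + 1 := fun k hk => by
    simpa [conwayTwists_odd] using lt_of_mem_twistIndices hk
  refine isMatroid_of_uIndependent_iff_ncard_le n fun W => ⟨fun hW => ?_, fun hW => ?_⟩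
  · by_contra! hn
    -- Switching any `n` of the `2n+1` crossings leaves one net twist, an unknot; so a set with more
    -- than `n` crossings has a proper unknotting subset.
    obtain ⟨T, hTW, hT⟩ := Set.exists_subset_card_eq hn.le
    refine hW (W \ T) Set.sdiff_subset ?_ ?_
    · rw [Set.nonempty_iff_ne_empty, Ne, Set.sdiff_eq_empty]
      intro h
      have := Set.ncard_le_ncard h
      omega
    · rw [Set.sdiff_sdiff_cancel_left hTW]
      refine isUnknottingSet_of_reduces ?_
      have h := netTwists_eq_of_forall_mem (T := twistIndices T) (o := 0) (n := 2 * n + 1)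
        (by simpa using hlt)
      simp only [add_zero] at h
      rw [conwayTwists_odd]
      refine ((reduces_switchAt_replicate _ _ _ _).append _ _).trans ?_
      rw [h, ← ncard_eq_card_twistIndices, hT]
      simpa [twistSign] using reduces_single_crossing
  · refine uIndependent_of_switchedDet fun T hT => ?_
    have h1 := Finset.card_lt_card hT
    rw [← ncard_eq_card_twistIndices] at h1
    -- A proper subset has at most `n - 1` crossings, so the determinant is at most `-3`.
    rw [switchedDet_odd n fun k hk => hlt k (hT.subset hk), le_abs]
    omega

end OneRow

/-! ### The diagrams `(2n, 2)` -/

section TwoRows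

variable (n : ℕ)

theorem conwayTwists_even_two :
    conwayTwists true [2 * (n : ℤ), 2] =
      List.replicate (2 * n) (Layer.cross 1 true) ++ List.replicate 2 (Layer.cross 0 false) := by
  rcases n with _ | n
  · rfl
  · simp [conwayTwists, show (2 * ((n : ℤ) + 1)).natAbs = 2 * (n + 1) by omega,
      show (0 : ℤ) < n + 1 by omega]

theorem switchedDet_even_two (T : Finset ℕ) :
    switchedDet [2 * (n : ℤ), 2] T =
      1 + netTwists (fun k => decide (k ∈ T)) (2 * n) *
        netTwists (fun k => decide (k + 2 * n ∈ T)) 2 := by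
  rw [switchedDet, conwayTwists_even_two, switchAt_append, List.foldl_append,
    foldl_twistState_switchAt_one, foldl_twistState_switchAt_zero, List.length_replicate]
  simp [capState, twistSign, mul_comm]

theorem not_isMatroid_conwayDiagram_even_two (hn : 2 ≤ n) :
    ¬ (conwayDiagram [2 * (n : ℤ), 2]).uSystem.IsMatroid := by
  have hlen : (conwayTwists true [2 * (n : ℤ), 2]).length = 2 * n + 2 := by
    simp [conwayTwists_even_two]
  -- `2 * n` is the first crossing of the second row: switching it cancels that row, and the first
  -- row then untwists at the cap. A proper subset of `{0, 1}` leaves at least `2n - 2` twists in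
  -- the first row, which is positive as `n ≥ 2`, so the determinant is at least `1 + 2 * (2n - 2)`.
  refine not_isMatroid_of_switchedDet {2 * n} {0, 1} ?_ ?_ (by simp) ?_ ?_ ?_
  · simp [hlen]
  · simp [hlen]
  · have h1 : netTwists (fun k => decide (k + 2 * n ∈ ({2 * n} : Finset ℕ))) 2 = 0 := by
      rw [netTwists_eq_of_forall_mem (by simp)]; simp
    have h2 : netTwists (fun k => decide (k ∈ ({2 * n} : Finset ℕ))) (2 * n) = 2 * n := by
      have := netTwists_eq_of_forall_notMem (T := {2 * n}) (o := 0) (n := 2 * n) (by simp)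
      simpa using this
    rw [conwayTwists_even_two, switchAt_append, List.length_replicate]
    refine (((reduces_switchAt_replicate _ _ _ _).append_left _).append
      [Layer.cup 0, Layer.cup 2] _).trans ?_
    rw [h1, mul_zero]
    refine (((reduces_switchAt_replicate _ _ _ _).append_right _).append
      [Layer.cup 0, Layer.cup 2] _).trans ?_
    have h3 : twistRow 0 0 = [] := rfl
    have h4 : twistSign true * (2 * (n : ℤ)) = ((2 * n : ℕ) : ℤ) := by simp [twistSign]
    rw [h2, h4, twistRow_natCast, h3, List.append_nil]
    have h5 := (reduces_replicate_cross_cap 1 true (2 * n)).append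
      [Layer.cup 0, Layer.cup 2] [Layer.cap 0]
    have h6 : Reduces ([Layer.cup 0, Layer.cup 2] ++ [Layer.cap 1] ++ [Layer.cap 0])
        [Layer.cup 0, Layer.cap 0] :=
      (Reduces.of_localMove (.zigzag_right 1)).append [Layer.cup 0] [Layer.cap 0]
    refine .trans ?_ h6
    rw [show conwayCaps [2 * (n : ℤ), 2].length = [Layer.cap 1] ++ [Layer.cap 0] from
      if_neg (show ¬ Odd 2 by decide)]
    simpa only [List.append_assoc] using h5
  · intro T hT
    obtain rfl := Finset.ssubset_singleton_iff.1 hT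
    have h1 := netTwists_eq_of_forall_notMem (T := ∅) (o := 0) (n := 2 * n) (by simp)
    have h2 := netTwists_eq_of_forall_notMem (T := ∅) (o := 2 * n) (n := 2) (by simp)
    simp only [add_zero] at h1
    rw [switchedDet_even_two, h1, h2, le_abs]
    push_cast
    omega
  · intro T hT
    have hT' : ∀ k ∈ T, k < 2 := fun k hk => by
      have := hT.subset hk
      simp at this
      omega
    have hc : T.card < 2 := Finset.card_lt_card hT
    have h1 := netTwists_eq_of_forall_mem (T := T) (o := 0) (n := 2 * n) fun k hk => by
      have := hT' k hk
      omega
    have h2 := netTwists_eq_of_forall_notMem (T := T) (o := 2 * n) (n := 2) fun k hk => by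
      have := hT' k hk
      omega
    simp only [add_zero] at h1
    rw [switchedDet_even_two, h1, h2, le_abs]
    push_cast
    omega

end TwoRows

/-! ### The diagrams `(2n+1, 1, 2n)` -/

section ThreeRows

variable (n : ℕ)

theorem conwayTwists_odd_one_even :
    conwayTwists true [2 * (n : ℤ) + 1, 1, 2 * (n : ℤ)] =
      List.replicate (2 * n + 1) (Layer.cross 1 true) ++
        (List.replicate 1 (Layer.cross 0 false) ++
          List.replicate (2 * n) (Layer.cross 1 true)) := by
  rcases n with _ | n
  · rfl
  · simp [conwayTwists, show (2 * ((n : ℤ) + 1)).natAbs = 2 * (n + 1) by omega,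
      show (2 * ((n : ℤ) + 1) + 1).natAbs = 2 * (n + 1) + 1 by omega,
      show (0 : ℤ) < n + 1 by omega, show (0 : ℤ) < 2 * (n + 1) + 1 by omega]

/-- The state evolves as `(0, 1)`, `(-a, 1)`, `(-a, 1 + b * a)`, and the last row subtracts `c * (1
+ b * a)` from the first component. -/
theorem switchedDet_odd_one_even (T : Finset ℕ) {a b c : ℤ}
    (ha : netTwists (fun k => decide (k + 0 ∈ T)) (2 * n + 1) = a)
    (hb : netTwists (fun k => decide (k + (2 * n + 1) ∈ T)) 1 = b)
    (hc : netTwists (fun k => decide (k + (2 * n + 2) ∈ T)) (2 * n) = c) :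
    switchedDet [2 * (n : ℤ) + 1, 1, 2 * (n : ℤ)] T = -(a + c * (1 + b * a)) := by
  have e (k : ℕ) : k + 1 + (2 * n + 1) = k + (2 * n + 2) := by omega
  simp only [add_zero] at ha
  rw [switchedDet, conwayTwists_odd_one_even, switchAt_append, switchAt_append, List.foldl_append,
    List.foldl_append, foldl_twistState_switchAt_one, foldl_twistState_switchAt_zero,
    foldl_twistState_switchAt_one]
  simp only [List.length_replicate, e, ha, hb, hc]
  simp [capState, twistSign, show Odd 3 by decide]
  ring

theorem not_isMatroid_conwayDiagram_odd_one_even (hn : 2 ≤ n) :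
    ¬ (conwayDiagram [2 * (n : ℤ) + 1, 1, 2 * (n : ℤ)]).uSystem.IsMatroid := by
  have hlen : (conwayTwists true [2 * (n : ℤ) + 1, 1, 2 * (n : ℤ)]).length = 4 * n + 2 := by
    simp [conwayTwists_odd_one_even]
    omega
  have e (k : ℕ) : k + 1 + (2 * n + 1) = k + (2 * n + 2) := by omega
  -- Switching the first set leaves the net twists `1, -1, 2n`, with determinant `-1`. The second
  -- set consists of `n + 2` crossings of the last row, one more than the first set has; they fit
  -- into its `2n` crossings because `n ≥ 2`.
  refine not_isMatroid_of_switchedDet (insert (2 * n + 1) (Finset.range n))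
    (Finset.Ico (2 * n + 2) (3 * n + 4)) ?_ ?_ ?_ ?_ ?_ ?_
  · intro k hk
    simp at hk
    omega
  · intro k hk
    simp at hk
    omega
  · rw [Finset.card_insert_of_notMem (by simp; omega)]
    simp
    omega
  · have h1 : netTwists (fun k => decide (k ∈ insert (2 * n + 1) (Finset.range n)))
        (2 * n + 1) = 1 := by
      have := netTwists_mem (insert (2 * n + 1) (Finset.range n)) 0 (2 * n + 1)
      rw [Finset.filter_insert, if_neg (by omega), Finset.filter_true_of_mem (by simp; omega)]
        at this
      simpa using this
    have h2 : netTwists (fun k => decide (k + (2 * n + 1) ∈ insert (2 * n + 1) (Finset.range n)))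
        1 = -1 := by
      rw [netTwists_mem, Finset.filter_insert, if_pos (by omega),
        Finset.filter_false_of_mem (by simp; omega)]
      simp
    have h3 : netTwists (fun k => decide (k + (2 * n + 2) ∈ insert (2 * n + 1) (Finset.range n)))
        (2 * n) = (2 * n : ℕ) := by
      refine netTwists_eq_of_forall_notMem fun k hk => ?_
      simp at hk
      omega
    have h4 : twistSign true * ((2 * n : ℕ) : ℤ) = ((2 * n : ℕ) : ℤ) := by simp [twistSign]
    rw [conwayTwists_odd_one_even, switchAt_append, switchAt_append]
    simp only [List.length_replicate, e]
    refine (((reduces_switchAt_replicate _ _ _ _).append_right _).append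
      [Layer.cup 0, Layer.cup 2] _).trans ?_
    rw [h1]
    refine ((((reduces_switchAt_replicate _ _ _ _).append_right _).append_left
      [Layer.cross 1 true]).append [Layer.cup 0, Layer.cup 2] _).trans ?_
    rw [h2]
    refine ((((reduces_switchAt_replicate _ _ _ _).append_left [Layer.cross 0 true]).append_left
      [Layer.cross 1 true]).append [Layer.cup 0, Layer.cup 2] _).trans ?_
    rw [h3, h4, twistRow_natCast]
    -- Sliding a cup turns the remaining crossing of the first row into one that cancels the
    -- switched middle crossing; the whole last row then untwists at that cup.
    have r1 : Reduces [Layer.cup 0, Layer.cup 2] [Layer.cup 0, Layer.cup 0] :=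
      .of_localMove (.exchange .cup .cup 0 0)
    have r2 : Reduces [Layer.cup 0, Layer.cross 1 true] [Layer.cup 1, Layer.cross 0 false] :=
      .of_localMove (.slide_cup 0 true)
    have r3 : Reduces [Layer.cross 0 false, Layer.cross 0 true] [] :=
      .of_localMove (.reidemeister_two 0 false)
    have r4 := reduces_cup_replicate_cross 1 true (2 * n)
    have r5 : Reduces [Layer.cup 1, Layer.cap 0] [] := .of_localMove (.zigzag_right 0)
    refine (r1.append_right ([Layer.cross 1 true] ++ ([Layer.cross 0 true] ++
      List.replicate (2 * n) (Layer.cross 1 true)) ++ conwayCaps 3)).trans ?_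
    refine (r2.append [Layer.cup 0] ([Layer.cross 0 true] ++
      List.replicate (2 * n) (Layer.cross 1 true) ++ conwayCaps 3)).trans ?_
    refine (r3.append [Layer.cup 0, Layer.cup 1]
      (List.replicate (2 * n) (Layer.cross 1 true) ++ conwayCaps 3)).trans ?_
    refine (r4.append [Layer.cup 0] (conwayCaps 3)).trans ?_
    exact r5.append [Layer.cup 0] [Layer.cap 0]
  · intro T hT
    have hmem : ∀ k ∈ T, k = 2 * n + 1 ∨ k < n := fun k hk => by simpa using hT.subset hk
    have hcard : T.card < n + 1 := by
      have := Finset.card_lt_card hT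
      rwa [Finset.card_insert_of_notMem (by simp; omega), Finset.card_range] at this
    have h3 : netTwists (fun k => decide (k + (2 * n + 2) ∈ T)) (2 * n) = (2 * n : ℕ) :=
      netTwists_eq_of_forall_notMem fun k hk => by have := hmem k hk; omega
    rw [switchedDet_odd_one_even n T (netTwists_mem T 0 _) (netTwists_mem T _ 1) h3]
    have hsplit : ({k ∈ T | 0 ≤ k ∧ k < 0 + (2 * n + 1)}).card +
        ({k ∈ T | 2 * n + 1 ≤ k ∧ k < 2 * n + 1 + 1}).card ≤ T.card := by
      rw [← Finset.card_union_of_disjoint]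
      · exact Finset.card_le_card (Finset.union_subset (Finset.filter_subset _ _)
          (Finset.filter_subset _ _))
      · refine Finset.disjoint_filter.2 fun k _ h h' => ?_
        omega
    have hone : ({k ∈ T | 2 * n + 1 ≤ k ∧ k < 2 * n + 1 + 1}).card ≤ 1 := by
      refine Finset.card_le_one.2 fun a ha b hb => ?_
      simp only [Finset.mem_filter] at ha hb
      omega
    generalize ({k ∈ T | 0 ≤ k ∧ k < 0 + (2 * n + 1)}).card = s at *
    generalize ({k ∈ T | 2 * n + 1 ≤ k ∧ k < 2 * n + 1 + 1}).card = t at *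
    have hn' : (2 : ℤ) ≤ n := by exact_mod_cast hn
    rw [le_abs]
    push_cast
    -- Here `a = 2n + 1 - 2s` and `c = 2n`. If the middle crossing is not switched, `a ≥ 1` and `a +
    -- c * (1 + a) ≥ 4n + 1`. If it is, properness forces `s ≤ n - 1`, so `a ≥ 3` and `a + c * (1 -
    -- a) ≤ 3 - 4n`.
    obtain rfl | rfl : t = 0 ∨ t = 1 := by omega
    · right
      have hs : (s : ℤ) ≤ n := by omega
      push_cast
      nlinarith
    · left
      have hs : (s : ℤ) + 1 ≤ n := by omega
      push_cast
      nlinarith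
  · intro T hT
    have hmem : ∀ k ∈ T, 2 * n + 2 ≤ k := fun k hk => (Finset.mem_Ico.1 (hT.subset hk)).1
    have h1 : netTwists (fun k => decide (k + 0 ∈ T)) (2 * n + 1) = (2 * n + 1 : ℕ) :=
      netTwists_eq_of_forall_notMem fun k hk => by have := hmem k hk; omega
    have h2 : netTwists (fun k => decide (k + (2 * n + 1) ∈ T)) 1 = (1 : ℕ) :=
      netTwists_eq_of_forall_notMem fun k hk => by have := hmem k hk; omega
    rw [switchedDet_odd_one_even n T h1 h2 (netTwists_mem T _ _)]
    generalize ({k ∈ T | 2 * n + 2 ≤ k ∧ k < 2 * n + 2 + 2 * n}).card = u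
    have hn' : (2 : ℤ) ≤ n := by exact_mod_cast hn
    rw [le_abs]
    push_cast
    -- With `a = 2n + 1`, `b = 1` and `c = 2n - 2u` even, `a + c * (1 + a)` is at least `2n + 1` for
    -- `c ≥ 0` and at most `-2n - 3` for `c ≤ -2`. Thus no set of crossings of the last row unknots.
    obtain h | h := le_or_gt u n
    · right
      have hu : (u : ℤ) ≤ n := by exact_mod_cast h
      nlinarith
    · left
      have hu : (n : ℤ) + 1 ≤ u := by exact_mod_cast h
      nlinarith

end ThreeRows

end LinkDiagram

/-! ### The diagrams `(2n+1, 2, -2, …, 2, -2)` -/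

namespace LinkDiagram

/-- The twists of the rows `2, -2`. -/
def twistBlock : List Layer :=
  [Layer.cross 0 false, Layer.cross 0 false, Layer.cross 1 false, Layer.cross 1 false]

/-- The twists of `n` pairs of rows `2, -2`. -/
def twistBlocks (n : ℕ) : List Layer := (List.replicate n twistBlock).flatten

theorem twistBlocks_succ (n : ℕ) : twistBlocks (n + 1) = twistBlock ++ twistBlocks n := by
  simp [twistBlocks, List.replicate_succ]

theorem length_twistBlocks (n : ℕ) : (twistBlocks n).length = 4 * n := by
  simp [twistBlocks, twistBlock, mul_comm]

theorem conwayTwists_pairs (n : ℕ) :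
    conwayTwists false (List.replicate n [2, -2]).flatten = twistBlocks n := by
  induction n with
  | zero => rfl
  | succ n ih =>
    rw [List.replicate_succ, List.flatten_cons, twistBlocks_succ, ← ih]
    rfl

theorem conwayTwists_odd_pairs (n : ℕ) :
    conwayTwists true ((2 * (n : ℤ) + 1) :: (List.replicate n [2, -2]).flatten) =
      List.replicate (2 * n + 1) (Layer.cross 1 true) ++ twistBlocks n := by
  rw [conwayTwists, Bool.not_true, conwayTwists_pairs]
  congr 2
  simp

theorem length_odd_pairs (n : ℕ) :
    ((2 * (n : ℤ) + 1) :: (List.replicate n [2, -2]).flatten).length = 2 * n + 1 := by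
  simp [mul_comm]

theorem conwayCaps_odd (n : ℕ) : conwayCaps (2 * n + 1) = conwayCaps 1 := by
  simp [conwayCaps]

/-- The states that cannot be brought back to a trivial one by further rows `2, -2`. -/
def DominatedState (s : ℤ × ℤ) : Prop := (0 < s.2 ∧ s.2 < s.1) ∨ (s.1 < s.2 ∧ s.2 < 0)

theorem DominatedState.two_le_abs {s : ℤ × ℤ} (h : DominatedState s) : 2 ≤ |s.1| := by
  rw [le_abs]
  unfold DominatedState at h
  omega

/-- Only the first crossing of a block may be switched. Doing so cancels the row `2`, leaving just
the transvection of the row `-2`. -/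
theorem foldl_twistState_switchAt_twistBlock {P : ℕ → Bool} (hP : ∀ k, ¬ 4 ∣ k → P k = false)
    (s : ℤ × ℤ) : (switchAt P twistBlock).foldl twistState s =
      if P 0 then (s.1 + 2 * s.2, s.2) else (2 * s.2 - 3 * s.1, s.2 - 2 * s.1) := by
  have h1 := hP 1 (by decide)
  have h2 := hP 2 (by decide)
  have h3 := hP 3 (by decide)
  cases h0 : P 0
  · simp [twistBlock, h0, h1, h2, h3, twistSign]
    constructor <;> ring
  · simp [twistBlock, h0, h1, h2, h3, twistSign]
    ring

/-- For `0 < s.2 < s.1`, a switched block increases `s.1` and fixes `s.2`; an unswitched one gives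
`2 * s.2 - 3 * s.1 < s.2 - 2 * s.1 < 0`. The other sign is symmetric. -/
theorem DominatedState.foldl_twistBlocks {n : ℕ} {P : ℕ → Bool}
    (hP : ∀ k, ¬ 4 ∣ k → P k = false) {s : ℤ × ℤ} (h : DominatedState s) :
    DominatedState ((switchAt P (twistBlocks n)).foldl twistState s) := by
  induction n generalizing P s with
  | zero => simpa [twistBlocks] using h
  | succ n ih =>
    rw [twistBlocks_succ, switchAt_append, List.foldl_append]
    refine ih (fun k hk => hP _ fun h4 => hk ?_) ?_
    · exact (Nat.dvd_add_left (by decide)).1 h4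
    · rw [foldl_twistState_switchAt_twistBlock hP]
      unfold DominatedState at h ⊢
      split_ifs
      all_goals
        dsimp only
        omega

/-- Each switched block only lowers `a` by `2`. The bound keeps `a` positive until the first
unswitched block, which makes the state dominated for good. -/
theorem dominatedState_foldl_twistBlocks {n : ℕ} {P : ℕ → Bool}
    (hP : ∀ k, ¬ 4 ∣ k → P k = false) (hn : ∃ i < n, P (4 * i) = false) {a : ℤ}
    (ha : 2 * n + 1 ≤ a) :
    DominatedState ((switchAt P (twistBlocks n)).foldl twistState (-a, 1)) := by
  induction n generalizing P a with
  | zero => simp at hn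
  | succ n ih =>
    have hP' : ∀ k, ¬ 4 ∣ k → P (k + twistBlock.length) = false := fun k hk =>
      hP _ fun h4 => hk ((Nat.dvd_add_left (by decide)).1 h4)
    rw [twistBlocks_succ, switchAt_append, List.foldl_append,
      foldl_twistState_switchAt_twistBlock hP]
    push_cast at ha
    split_ifs with h0
    · rw [show ((-a, 1) : ℤ × ℤ).1 + 2 * ((-a, 1) : ℤ × ℤ).2 = -(a - 2) by ring]
      refine ih hP' ?_ (by omega)
      obtain ⟨i, hi, h⟩ := hn
      rcases i with _ | i
      · simp [h0] at h
      · exact ⟨i, by omega, by rw [← h]; rfl⟩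
    -- The new state is `(3a + 2, 2a + 1)`.
    · refine DominatedState.foldl_twistBlocks hP' (Or.inl ?_)
      dsimp only
      omega

theorem reduces_switchAt_twistBlocks {n : ℕ} {P : ℕ → Bool}
    (hP : ∀ k < 4 * n, P k = decide (4 ∣ k)) :
    Reduces (switchAt P (twistBlocks n)) (twistRow 1 (-(2 * n : ℕ))) := by
  induction n generalizing P with
  | zero => exact Reduces.refl _
  | succ n ih =>
    rw [twistBlocks_succ, switchAt_append]
    refine ((ih fun k hk => ?_).append_left _).trans ?_
    · rw [hP _ (by simp [twistBlock]; omega)]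
      exact decide_eq_decide.2 (Nat.dvd_add_left (by decide))
    · have h0 := hP 0 (by omega)
      have h1 := hP 1 (by omega)
      have h2 := hP 2 (by omega)
      have h3 := hP 3 (by omega)
      have h4 : switchAt P twistBlock =
          [Layer.cross 0 true, Layer.cross 0 false, Layer.cross 1 false, Layer.cross 1 false] := by
        simp [twistBlock, h0, h1, h2, h3]
      rw [h4, twistRow_neg_natCast, twistRow_neg_natCast]
      exact (Reduces.of_localMove (.reidemeister_two 0 true)).append_right _

theorem switchedDet_odd_pairs (n : ℕ) (T : Finset ℕ) {a : ℤ}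
    (ha : netTwists (fun k => decide (k + 0 ∈ T)) (2 * n + 1) = a) :
    switchedDet ((2 * (n : ℤ) + 1) :: (List.replicate n [2, -2]).flatten) T =
      ((switchAt (fun k => decide (k + (2 * n + 1) ∈ T)) (twistBlocks n)).foldl
        twistState (-a, 1)).1 := by
  simp only [add_zero] at ha
  rw [switchedDet, conwayTwists_odd_pairs, switchAt_append, List.foldl_append,
    foldl_twistState_switchAt_one, ha, length_odd_pairs, capState, if_pos (by simp)]
  simp [twistSign]

theorem not_isMatroid_conwayDiagram_odd_pairs (n : ℕ) (hn : 1 ≤ n) :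
    ¬ (conwayDiagram
      ((2 * (n : ℤ) + 1) :: (List.replicate n [2, -2]).flatten)).uSystem.IsMatroid := by
  have hlen : (conwayTwists true
      ((2 * (n : ℤ) + 1) :: (List.replicate n [2, -2]).flatten)).length = 2 * n + 1 + 4 * n := by
    simp [conwayTwists_odd_pairs, length_twistBlocks]
  have hinj : Function.Injective fun i => 2 * n + 1 + 4 * i := fun i j h => by
    dsimp only at h
    omega
  have hI {k : ℕ} : k ∈ (Finset.range n).image (fun i => 2 * n + 1 + 4 * i) ↔
      ∃ i < n, 2 * n + 1 + 4 * i = k := by simp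
  -- The first set takes the first crossing of every row `2`: these rows vanish, and the `n` rows
  -- `-2` merge with the first row to `2n + 1 - 2n = 1` twist. The second set is `n + 1` crossings
  -- of the first row.
  refine not_isMatroid_of_switchedDet ((Finset.range n).image fun i => 2 * n + 1 + 4 * i)
    (Finset.range (n + 1)) ?_ ?_ ?_ ?_ ?_ ?_
  · intro k hk
    obtain ⟨i, hi, rfl⟩ := hI.1 hk
    omega
  · intro k hk
    rw [Finset.mem_range] at hk
    omega
  · rw [Finset.card_image_of_injective _ hinj, Finset.card_range, Finset.card_range]
    omega
  · have h1 : netTwists (fun k => decide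
        (k + 0 ∈ (Finset.range n).image fun i => 2 * n + 1 + 4 * i)) (2 * n + 1) =
          (2 * n + 1 : ℕ) := netTwists_eq_of_forall_notMem fun k hk => by
      obtain ⟨i, hi, rfl⟩ := hI.1 hk
      omega
    simp only [add_zero] at h1
    rw [conwayTwists_odd_pairs, switchAt_append, List.length_replicate, length_odd_pairs,
      conwayCaps_odd]
    refine (((reduces_switchAt_twistBlocks fun k hk => ?_).append_left _).append
      [Layer.cup 0, Layer.cup 2] _).trans ?_
    · refine decide_eq_decide.2 (hI.trans ⟨?_, ?_⟩)
      · rintro ⟨i, hi, h⟩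
        omega
      · rintro ⟨i, rfl⟩
        exact ⟨i, by omega, by omega⟩
    · refine (((reduces_switchAt_replicate _ _ _ _).append_right _).append
        [Layer.cup 0, Layer.cup 2] _).trans ?_
      have h2 : twistSign true * ((2 * n + 1 : ℕ) : ℤ) = ((2 * n + 1 : ℕ) : ℤ) := by
        simp [twistSign]
      rw [h1, h2, twistRow_natCast]
      refine ((Reduces.replicate_append_twistRow 1 true _ _).append
        [Layer.cup 0, Layer.cup 2] _).trans ?_
      rw [h2, show ((2 * n + 1 : ℕ) : ℤ) + -((2 * n : ℕ) : ℤ) = 1 by push_cast; ring]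
      exact reduces_single_crossing
  · intro T hT
    have hmem : ∀ k ∈ T, ∃ i < n, 2 * n + 1 + 4 * i = k := fun k hk => hI.1 (hT.subset hk)
    have h1 : netTwists (fun k => decide (k + 0 ∈ T)) (2 * n + 1) = (2 * n + 1 : ℕ) :=
      netTwists_eq_of_forall_notMem fun k hk => by
        obtain ⟨i, hi, rfl⟩ := hmem k hk
        omega
    rw [switchedDet_odd_pairs n T h1]
    refine (dominatedState_foldl_twistBlocks (fun k hk => ?_) ?_ (by push_cast; omega)).two_le_abs
    · refine decide_eq_false fun h => hk ?_
      obtain ⟨i, hi, h⟩ := hmem _ h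
      omega
    · obtain ⟨k, hk, hkT⟩ := Finset.exists_of_ssubset hT
      obtain ⟨i, hi, rfl⟩ := hI.1 hk
      exact ⟨i, hi, decide_eq_false (by rwa [add_comm])⟩
  · intro T hT
    have hmem : ∀ k ∈ T, k < n + 1 := fun k hk => Finset.mem_range.1 (hT.subset hk)
    have hcard : T.card < n + 1 := by simpa using Finset.card_lt_card hT
    have h1 : netTwists (fun k => decide (k + 0 ∈ T)) (2 * n + 1) =
        (2 * n + 1 : ℕ) - 2 * T.card :=
      netTwists_eq_of_forall_mem fun k hk => by
        have := hmem k hk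
        omega
    rw [switchedDet_odd_pairs n T h1]
    -- A proper subset leaves `a = 2n + 1 - 2 * T.card ≥ 1` twists in the first row. As `n ≥ 1`
    -- there is a first block; it is not switched, and takes `(-a, 1)` to a dominated state.
    obtain ⟨m, rfl⟩ := Nat.exists_eq_add_of_le' hn
    have hP (k : ℕ) : decide (k + (2 * (m + 1) + 1) ∈ T) = false := decide_eq_false fun h => by
      have := hmem _ h
      omega
    rw [twistBlocks_succ, switchAt_append, List.foldl_append,
      foldl_twistState_switchAt_twistBlock fun k _ => hP k, if_neg (by rw [hP]; decide)]
    refine (DominatedState.foldl_twistBlocks (fun k _ => hP _) (Or.inl ?_)).two_le_abs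
    dsimp only
    push_cast
    omega

end LinkDiagram

theorem proposition2p6 :
    (∀ n : ℕ, 2 ≤ n →
      ¬ (conwayDiagram [2 * (n : ℤ) + 1, 1, 2 * (n : ℤ)]).uSystem.IsMatroid ∧
      ¬ (conwayDiagram
          ((2 * (n : ℤ) + 1) :: (List.replicate n [2, -2]).flatten)).uSystem.IsMatroid) ∧
    (∀ n : ℕ, 1 ≤ n → (conwayDiagram [2 * (n : ℤ) + 1]).uSystem.IsMatroid) ∧
    (∀ n : ℕ, 2 ≤ n → ¬ (conwayDiagram [2 * (n : ℤ), 2]).uSystem.IsMatroid) :=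
  ⟨fun n hn => ⟨LinkDiagram.not_isMatroid_conwayDiagram_odd_one_even n hn,
      LinkDiagram.not_isMatroid_conwayDiagram_odd_pairs n (by omega)⟩,
    fun n _ => LinkDiagram.isMatroid_conwayDiagram_odd n,
    fun n hn => LinkDiagram.not_isMatroid_conwayDiagram_even_two n hn⟩
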